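/- Let $D\subset\mathbb R^2$ be the open unit disk and let $E\subset\partial D$ be nonempty and open in the circle $\partial D$ (the set of tomography). A broken ray with endpoints in $E$ is a polygonal path with $n\ge 1$ segments of positive length and vertices $e^{i(\iota+l\alpha)}$, $l=0,\dots,n$, where $e^{i\iota},e^{i\kappa}\in E$ and $n\alpha=\kappa-\iota+2\pi m$ for some $m\in\mathbb Z$ (so it reflects at $\partial D$ according to geometrical optics, possibly also at points of $E$). The broken ray transform $\mathcal Gf$ assigns to each such path $\gamma$ the average of $f$ over $\gamma$ with respect to arc length. For a sequence $M=(M_n)_{n\ge0}$ of positive numbers and $\rho>0$, a $2\pi$-periodic function $g$ is said to be in $C^\#(M)$ with constant $\rho$ if it is the sum of a uniformly convergent series $g(\theta)=\sum_{k\ge 0}(a_k\cos k\theta+b_k\sin k\theta)$ with $\sum_{k\ge1}k^{2n}|a_k|^2\le M_n\rho^n$ and $\sum_{k\ge1}k^{2n}|b_k|^2\le M_n\rho^n$ for all $n\ge0$. The class $C^\#(M)$ is quasianalytic if $M$ is increasing (in the weak sense), logarithmically convex and satisfies $\sum_{n\ge0}\sqrt{M_n/M_{n+1}}=\infty$. A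 continuous $f:\bar D\to\mathbb R$ is uniformly quasianalytic in the angular variable if for each $R\in(0,1]$ there are a quasianalytic class $C^\#(M^{R})$ and a constant $\rho_R>0$ such that all the functions $f(r,\cdot)$, $R\le r\le1$ (in polar coordinates), are in $C^\#(M^{R})$ with constant $\rho_R$. A function on $\bar D$ satisfies the Dini–Lipschitz condition if its modulus of continuity $\omega$ satisfies $\omega(\delta)=o(1/\log(1/\delta))$ as $\delta\to0^+$. Theorem. Suppose that $f:\bar D\to\mathbb R$ is uniformly quasianalytic in the angular variable and that its angular derivatives $\partial_\theta^i f$ of all orders $i\ge0$ satisfy the Dini–Lipschitz condition on $\bar D$. Then $f$ is uniquely determined by its integrals over the broken rays with endpoints in $E$: if $\mathcal Gf(\gamma)=0$ for every such broken ray $\gamma$, then $f=0$ on $\bar D$. Consequently, if $f$ and $g$ are two such functions, uniformly quasianalytic with respect to the same classes $C^\#(M^{R})$, $R\in(0,1]$ (with possibly different constants $\rho_R$), and $\mathcal Gf(\gamma)=\mathcal Gg(\gamma)$ for every such broken ray $\gamma$, then $f=g$ on $\bar D$. -/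

import Mathlib

open scoped Topology

noncomputable section

namespace BrokenRayTomography

/-! ### Broken rays in the closed unit disk of the plane, which is identified with `ℂ` -/

/-- A broken ray in the unit disk with both endpoints in the set of tomography `E ⊆ ∂D`: it
consists of `n` line segments, starts at the boundary point with angle `ι`, ends at the one with
angle `κ`, each segment is seen from the origin at the angle `α`, and the integer `m` is the
winding number. Intermediate reflections on `E` are allowed. The last field excludes paths of
length zero. -/
structure BrokenRay (E : Set Circle) where
  n : ℕ
  m : ℤ
  α : ℝ
  ι : ℝ
  κ : ℝ
  n_pos : 0 < n
  initial_mem : Circle.exp ι ∈ E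
  final_mem : Circle.exp κ ∈ E
  trajectory : (n : ℝ) * α = κ - ι + 2 * Real.pi * m
  nondegenerate : Real.sin (α / 2) ≠ 0

namespace BrokenRay

variable {E : Set Circle}

/-- The `l`-th vertex of a broken ray, at angle `ι + l α`. The `0`-th vertex is the initial point,
the `n`-th vertex is the final point, and the others are the points of reflection. -/
def vertex (γ : BrokenRay E) (l : ℕ) : ℂ := (Circle.exp (γ.ι + l * γ.α) : ℂ)

/-- The total length of a broken ray. -/
def length (γ : BrokenRay E) : ℝ :=
  ∑ l ∈ Finset.range γ.n, dist (γ.vertex l) (γ.vertex (l + 1))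

end BrokenRay

/-- The integral of `f` with respect to arc length over the line segment from `p` to `q`. -/
def segmentIntegral (f : ℂ → ℝ) (p q : ℂ) : ℝ :=
  dist p q * ∫ s in (0 : ℝ)..1, f (AffineMap.lineMap p q s)

/-- The unnormalized broken ray transform: the integral of `f` along a broken ray. -/
def unnormalizedTransform {E : Set Circle} (f : ℂ → ℝ) (γ : BrokenRay E) : ℝ :=
  ∑ l ∈ Finset.range γ.n, segmentIntegral f (γ.vertex l) (γ.vertex (l + 1))

/-- The broken ray transform: the average of `f` along a broken ray. -/
def brokenRayTransform {E : Set Circle} (f : ℂ → ℝ) (γ : BrokenRay E) : ℝ :=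
  unnormalizedTransform f γ / γ.length

/-! ### The Dini–Lipschitz condition -/

/-- The modulus of continuity of `g` on the set `s`. -/
def modulusOfContinuity (g : ℂ → ℝ) (s : Set ℂ) (δ : ℝ) : ENNReal :=
  ⨆ x ∈ s, ⨆ y ∈ s, ⨆ _ : dist x y ≤ δ, edist (g x) (g y)

/-- The Dini–Lipschitz condition on `s`: the modulus of continuity is `o(1 / log (1 / δ))` as
`δ → 0+`. -/
def DiniLipschitzOn (g : ℂ → ℝ) (s : Set ℂ) : Prop :=
  Filter.Tendsto (fun δ : ℝ => modulusOfContinuity g s δ * ENNReal.ofReal (Real.log (1 / δ)))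
    (𝓝[>] 0) (𝓝 0)

/-- The angular derivative of order `i`. -/
def angularDeriv (i : ℕ) (f : ℂ → ℝ) (x : ℂ) : ℝ :=
  iteratedDeriv i (fun θ : ℝ => f ((Circle.exp θ : ℂ) * x)) 0

/-- All angular derivatives of `f`, including `f` itself, satisfy the Dini–Lipschitz condition in
the closed unit disk. -/
def AngularDerivativesDiniLipschitz (f : ℂ → ℝ) : Prop :=
  ∀ i : ℕ, DiniLipschitzOn (angularDeriv i f) (Metric.closedBall 0 1)

/-! ### Quasianalyticity -/

/-- `M` is an increasing logarithmically convex sequence of positive numbers for which the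
corresponding class of sequences (or of `2π`-periodic functions) is quasianalytic. -/
structure IsQuasianalyticWeight (M : ℕ → ℝ) : Prop where
  pos : ∀ n, 0 < M n
  mono : Monotone M
  log_convex : ∀ n, 2 * Real.log (M (n + 1)) ≤ Real.log (M n) + Real.log (M (n + 2))
  diverges : ¬ Summable fun n : ℕ => Real.sqrt (M n / M (n + 1))

/-- The sequence `(a k)`, `k ≥ 1`, belongs to the class `S^#(M)` with the constant `ρ`:
`∑_{k ≥ 1} k ^ (2 n) |a k| ^ 2 ≤ M n * ρ ^ n` for every `n`. -/
def SSharpWith (M : ℕ → ℝ) (ρ : ℝ) (a : ℕ → ℝ) : Prop :=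
  ∀ n : ℕ, Summable (fun k : ℕ => ((k : ℝ) + 1) ^ (2 * n) * |a (k + 1)| ^ 2) ∧
    ∑' k : ℕ, ((k : ℝ) + 1) ^ (2 * n) * |a (k + 1)| ^ 2 ≤ M n * ρ ^ n

/-- The function `g` belongs to the class `C^#(M)` of `2π`-periodic functions with the
constant `ρ`: it is the sum of a uniformly convergent trigonometric series whose coefficient
sequences belong to `S^#(M)` with the constant `ρ`. -/
def CSharpWith (M : ℕ → ℝ) (ρ : ℝ) (g : ℝ → ℝ) : Prop :=
  ∃ a b : ℕ → ℝ, SSharpWith M ρ a ∧ SSharpWith M ρ b ∧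
    TendstoUniformly
      (fun (K : ℕ) (x : ℝ) => ∑ k ∈ Finset.range K,
        (a k * Real.cos (k * x) + b k * Real.sin (k * x)))
      g Filter.atTop

/-- `f` is continuous in the closed unit disk, and for each `R ∈ (0, 1]` the collection of the
functions `f(r, ·)` with `R ≤ r ≤ 1` belongs (with one constant for the collection) to the
class `C^#(𝓜 R)`. -/
def UniformlyInClasses (𝓜 : ℝ → ℕ → ℝ) (f : ℂ → ℝ) : Prop :=
  ContinuousOn f (Metric.closedBall 0 1) ∧
    ∀ R ∈ Set.Ioc (0 : ℝ) 1, ∃ ρ : ℝ, 0 < ρ ∧ ∀ r ∈ Set.Icc R 1,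
      CSharpWith (𝓜 R) ρ (fun θ : ℝ => f ((r : ℂ) * (Circle.exp θ : ℂ)))

/-- `f` is uniformly quasianalytic in the angular variable: for each `R ∈ (0, 1]` the functions
`f(r, ·)` with `R ≤ r ≤ 1` belong to the same quasianalytic class. -/
def UniformlyQuasianalytic (f : ℂ → ℝ) : Prop :=
  ∃ 𝓜 : ℝ → ℕ → ℝ, (∀ R ∈ Set.Ioc (0 : ℝ) 1, IsQuasianalyticWeight (𝓜 R)) ∧
    UniformlyInClasses 𝓜 f

end BrokenRayTomography

end

open BrokenRayTomography

/-!
Let `F_α(φ)` be the mean of `f` over the chord from `e^{iφ}` to `e^{i(φ + α)}`. The transform of a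
broken ray with initial angle `ι`, opening angle `α` and `n` segments is the average of
`F_α(ι + l α)` over `l < n`. Fix `α` with `α / 2π` irrational, and choose `n ≥ 1` with `n α` so close
to `2π ℤ` that for all `ι` in some interval both `e^{iι}` and `e^{i(ι + n α)}` lie in `E`. Then
`S(ι) = ∑_{l < n} F_α(ι + l α)` vanishes on that interval.

The chords of opening angle `α` stay in an annulus `R ≤ |x| ≤ 1`, where the class `C^#(𝓜 R)` bounds all
angular derivatives of `f` by a weight that satisfies the Denjoy–Carleman condition. Integration over
chords preserves these bounds (`AngularJet.hasDerivAt_chordMean`), so `S` is quasianalytic and vanishes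
identically (`denjoy_carleman`, by Bang's argument). Now `S(φ + α) - S(φ) = F_α(φ + n α) - F_α(φ)`,
hence `F_α` has the incommensurable periods `n α` and `2π` and is constant; as `S = 0`, it is zero
(`AngularJet.chordMean_eq_zero_of_irrational`).

By continuity in `α` the integrals of `f` over all chords vanish, and `f = 0` by the Fourier slice
theorem and Fourier inversion (`eqOn_zero_of_chordMean_eq_zero`). For two functions the argument
applies to their difference, which is why it runs under the hypotheses `AngularJet`, stable under
subtraction.
-/

namespace BrokenRayTomography

/-! ### The Denjoy–Carleman theorem -/

/-- The step in Bang's proof of the Denjoy–Carleman theorem. The size of a jet `(G j x)` is measured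
by the least `b` with `|G j x| ≤ b e ^ j M j` for all `j`. If this size is at most `e ^ (-(N + 1))`
at `x`, then it is at most `e ^ (-N)` up to the distance `M N / (e M (N + 1))` to the right of `x`:
the entries of order `≥ N + 1` are that small anyway by the global bound, and the lower ones are
integrated. -/
theorem bang_step {G : ℕ → ℝ → ℝ} {M : ℕ → ℝ} (hG : ∀ n x, HasDerivAt (G n) (G (n + 1) x) x)
    (hM : ∀ n, 0 < M n) (hb : ∀ n x, |G n x| ≤ M n)
    (hlc : Monotone fun n => M (n + 1) / M n) {N : ℕ} {x : ℝ}
    (hx : ∀ j : ℕ, |G j x| ≤ Real.exp (j - (N + 1)) * M j) {y : ℝ}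
    (hy : y ∈ Set.Icc x (x + Real.exp (-1) * (M N / M (N + 1)))) (j : ℕ) :
    |G j y| ≤ Real.exp (j - N) * M j := by
  set μ := M (N + 1) / M N with hμ
  have hμ0 : 0 < μ := div_pos (hM _) (hM _)
  -- Bounds for `G j`, `j ≤ N + 1`, by downward induction on `j`.
  have key : ∀ i ≤ N + 1, ∀ z, x ≤ z → |G (N + 1 - i) z| ≤
      Real.exp (((N + 1 - i : ℕ) : ℝ) - (N + 1)) * M (N + 1 - i) *
        Real.exp (Real.exp 1 * μ * (z - x)) := by
    intro i
    induction i with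
    | zero =>
      intro _ z hz
      have h1 : 1 ≤ Real.exp (Real.exp 1 * μ * (z - x)) :=
        Real.one_le_exp (mul_nonneg (by positivity) (by linarith))
      have h2 := hb (N + 1) z
      simp only [Nat.sub_zero, Nat.cast_add, Nat.cast_one, sub_self, Real.exp_zero, one_mul]
      exact h2.trans (le_mul_of_one_le_right (hM _).le h1)
    | succ i ih =>
      intro hi z hz
      obtain ⟨k, hk⟩ : ∃ k, k + 1 = N + 1 - i := ⟨N - i, by omega⟩
      have hk' : N + 1 - (i + 1) = k := by omega
      rw [← hk] at ih
      rw [hk']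
      have hkM : M (k + 1) ≤ μ * M k := by
        have := hlc (show k ≤ N by omega)
        simp only at this
        rw [← hμ, div_le_iff₀ (hM k)] at this
        exact this
      refine image_norm_le_of_norm_deriv_right_le_deriv_boundary (f := G k) (f' := G (k + 1))
        (a := x) (b := z)
        (B := fun z => Real.exp ((k : ℝ) - (N + 1)) * M k * Real.exp (Real.exp 1 * μ * (z - x)))
        (B' := fun z => Real.exp ((k : ℝ) - (N + 1)) * M k *
          (Real.exp (Real.exp 1 * μ * (z - x)) * (Real.exp 1 * μ)))
        (fun t _ => (hG k t).continuousAt.continuousWithinAt) (fun t _ => (hG k t).hasDerivWithinAt)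
        (by simpa using hx k) (fun t => ?_) (fun t ht => ?_) (Set.right_mem_Icc.2 hz)
      · refine HasDerivAt.const_mul _ (HasDerivAt.exp ?_)
        simpa using ((hasDerivAt_id t).sub_const x).const_mul (Real.exp 1 * μ)
      · refine (ih (by omega) t ht.1).trans ?_
        have : Real.exp (((k + 1 : ℕ) : ℝ) - (N + 1)) =
            Real.exp ((k : ℝ) - (N + 1)) * Real.exp 1 := by
          rw [← Real.exp_add]; push_cast; ring_nf
        rw [this]
        calc _ = Real.exp ((k : ℝ) - (N + 1)) * Real.exp 1 *
              Real.exp (Real.exp 1 * μ * (t - x)) * M (k + 1) := by ring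
          _ ≤ Real.exp ((k : ℝ) - (N + 1)) * Real.exp 1 *
              Real.exp (Real.exp 1 * μ * (t - x)) * (μ * M k) := by gcongr
          _ = _ := by ring
  rcases le_or_gt j N with hj | hj
  · have h := key (N + 1 - j) (by omega) y hy.1
    rw [show N + 1 - (N + 1 - j) = j by omega] at h
    refine h.trans ?_
    have h1 : Real.exp 1 * μ * (y - x) ≤ 1 := by
      have : y - x ≤ Real.exp (-1) * (M N / M (N + 1)) := by linarith [hy.2]
      calc _ ≤ Real.exp 1 * μ * (Real.exp (-1) * (M N / M (N + 1))) := by gcongr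
        _ = (Real.exp 1 * Real.exp (-1)) * ((M (N + 1) / M N) * (M N / M (N + 1))) := by
          rw [hμ]; ring
        _ = 1 := by
          rw [← Real.exp_add, div_mul_div_cancel₀ (hM N).ne', div_self (hM _).ne']; simp
    have h2 : Real.exp ((j : ℝ) - N) = Real.exp ((j : ℝ) - (N + 1)) * Real.exp 1 := by
      rw [← Real.exp_add]; ring_nf
    rw [h2]
    calc _ ≤ Real.exp ((j : ℝ) - (N + 1)) * M j * Real.exp 1 := by
          have := (hM j).le
          gcongr
      _ = _ := by ring
  · refine (hb j y).trans (le_mul_of_one_le_left (hM j).le (Real.one_le_exp ?_))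
    have : (N : ℝ) ≤ j := by exact_mod_cast hj.le
    linarith

/-- The Denjoy–Carleman theorem. The sequence `G` consists of a function and its successive
derivatives, and the assumption on the ratios of `M` is logarithmic convexity. -/
theorem denjoy_carleman {G : ℕ → ℝ → ℝ} {M : ℕ → ℝ}
    (hG : ∀ n x, HasDerivAt (G n) (G (n + 1) x) x)
    (hM : ∀ n, 0 < M n) (hb : ∀ n x, |G n x| ≤ M n)
    (hlc : Monotone fun n => M (n + 1) / M n) (hdiv : ¬ Summable fun n => M n / M (n + 1))
    {x : ℝ} (hx : ∀ j, G j x = 0) {y : ℝ} (hxy : x ≤ y) : G 0 y = 0 := by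
  have hdiv' : ∀ N, ¬ Summable fun n => Real.exp (-1) * (M (n + N) / M (n + N + 1)) := by
    intro N h
    rw [summable_mul_left_iff (Real.exp_pos _).ne'] at h
    exact hdiv ((summable_nat_add_iff (f := fun n => M n / M (n + 1)) N).1 h)
  -- Starting from the flat point, walk `K` steps, each raising the bound by a factor `e`.
  have walk : ∀ K N : ℕ, ∀ z ∈ Set.Icc x
      (x + ∑ n ∈ Finset.range K, Real.exp (-1) * (M (n + N) / M (n + N + 1))),
      ∀ j : ℕ, |G j z| ≤ Real.exp (j - N) * M j := by
    intro K
    induction K with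
    | zero =>
      intro N z hz j
      simp only [Finset.range_zero, Finset.sum_empty, add_zero, Set.Icc_self,
        Set.mem_singleton_iff] at hz
      rw [hz, hx j, abs_zero]
      have := hM j
      positivity
    | succ K ih =>
      intro N z hz j
      have hsum : ∑ n ∈ Finset.range (K + 1), Real.exp (-1) * (M (n + N) / M (n + N + 1)) =
          (∑ n ∈ Finset.range K, Real.exp (-1) * (M (n + (N + 1)) / M (n + (N + 1) + 1))) +
            Real.exp (-1) * (M N / M (N + 1)) := by
        rw [Finset.sum_range_succ']
        simp only [zero_add]
        congr 1
        refine Finset.sum_congr rfl fun n _ => ?_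
        rw [show n + 1 + N = n + (N + 1) by ring]
      rw [hsum] at hz
      set s := ∑ n ∈ Finset.range K, Real.exp (-1) * (M (n + (N + 1)) / M (n + (N + 1) + 1))
      have hs : 0 ≤ s := Finset.sum_nonneg fun n _ => by
        have := hM (n + (N + 1)); have := hM (n + (N + 1) + 1); positivity
      have hp : ∀ w ∈ Set.Icc x (x + s), ∀ j : ℕ, |G j w| ≤ Real.exp (j - (N + 1)) * M j := by
        intro w hw j
        have := ih (N + 1) w hw j
        push_cast at this
        exact this
      have hN : 0 < Real.exp (-1) * (M N / M (N + 1)) := by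
        have := hM N; have := hM (N + 1); positivity
      rcases le_total z (x + s) with hzs | hzs
      · exact bang_step hG hM hb hlc (hp z ⟨hz.1, hzs⟩) ⟨le_rfl, by linarith⟩ j
      · exact bang_step hG hM hb hlc (hp (x + s) ⟨by linarith, le_rfl⟩)
          ⟨hzs, by linarith [hz.2]⟩ j
  have hbound : ∀ N : ℕ, |G 0 y| ≤ Real.exp (-N) * M 0 := by
    intro N
    have hnn : ∀ n, 0 ≤ Real.exp (-1) * (M (n + N) / M (n + N + 1)) := fun n => by
      have := hM (n + N); have := hM (n + N + 1); positivity
    have ht := (not_summable_iff_tendsto_nat_atTop_of_nonneg hnn).1 (hdiv' N)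
    obtain ⟨K, hK⟩ := (ht.eventually_ge_atTop (y - x)).exists
    simpa using walk K N y ⟨hxy, by linarith⟩ 0
  have hlim : Filter.Tendsto (fun N : ℕ => Real.exp (-(N : ℝ)) * M 0) Filter.atTop (𝓝 0) := by
    have := (Real.tendsto_exp_neg_atTop_nhds_zero.comp tendsto_natCast_atTop_atTop).mul_const (M 0)
    simpa using this
  exact abs_nonpos_iff.1 (ge_of_tendsto' hlim hbound)

/-! ### Injectivity of the X-ray transform in the disk -/

/-- The mean of `h` over the chord of the unit disk from `e^{iφ}` to `e^{i(φ + α)}`. -/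
noncomputable def chordMean (h : ℂ → ℝ) (φ α : ℝ) : ℝ :=
  ∫ s in (0 : ℝ)..1, h ((Circle.exp φ : ℂ) * AffineMap.lineMap 1 (Circle.exp α : ℂ) s)

/-- The line `{u (s + i t) | t ∈ ℝ}` misses the disk or cuts it in the chord from `e^{i(ψ - β)}` to
`e^{i(ψ + β)}`, where `u = e^{iψ}` and `s = cos β`. -/
theorem integral_line_indicator_eq_zero {h : ℂ → ℝ}
    (hX : ∀ φ α : ℝ, chordMean h φ α = 0) (u : Circle) (s : ℝ) :
    ∫ t : ℝ, (Metric.closedBall (0 : ℂ) 1).indicator h ((u : ℂ) * ⟨s, t⟩) = 0 := by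
  have hnorm : ∀ t : ℝ, ‖(u : ℂ) * ⟨s, t⟩‖ ^ 2 = s ^ 2 + t ^ 2 := fun t => by
    rw [norm_mul, Circle.norm_coe, one_mul, Complex.sq_norm, Complex.normSq_mk]; ring
  have hmem : ∀ t : ℝ, (u : ℂ) * ⟨s, t⟩ ∈ Metric.closedBall (0 : ℂ) 1 ↔ s ^ 2 + t ^ 2 ≤ 1 :=
    fun t => by rw [mem_closedBall_zero_iff, ← hnorm, sq_le_one_iff₀ (norm_nonneg _)]
  rcases lt_or_ge 1 (s ^ 2) with hs | hs
  · refine MeasureTheory.integral_eq_zero_of_ae (Filter.Eventually.of_forall fun t => ?_)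
    refine Set.indicator_of_notMem ?_ _
    rw [hmem]
    nlinarith [sq_nonneg t]
  · obtain ⟨hs1, hs2⟩ := abs_le.1 ((sq_le_one_iff_abs_le_one s).1 hs)
    set β := Real.arccos s with hβ
    have hc : Real.cos β = s := Real.cos_arccos hs1 hs2
    have hw0 : 0 ≤ Real.sin β :=
      Real.sin_nonneg_of_nonneg_of_le_pi (Real.arccos_nonneg s) (Real.arccos_le_pi s)
    have hsc := Real.sin_sq_add_cos_sq β
    rw [hc] at hsc
    have hIcc : ∀ t : ℝ, s ^ 2 + t ^ 2 ≤ 1 ↔ t ∈ Set.Icc (-Real.sin β) (Real.sin β) := fun t => by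
      rw [Set.mem_Icc, ← abs_le, ← sq_le_sq₀ (abs_nonneg t) hw0, sq_abs]
      constructor <;> intro h' <;> linarith
    have h1 : (fun t : ℝ => (Metric.closedBall (0 : ℂ) 1).indicator h ((u : ℂ) * ⟨s, t⟩)) =
        (Set.Icc (-Real.sin β) (Real.sin β)).indicator (fun t => h ((u : ℂ) * ⟨s, t⟩)) := by
      funext t
      by_cases ht : t ∈ Set.Icc (-Real.sin β) (Real.sin β)
      · rw [Set.indicator_of_mem ht, Set.indicator_of_mem ((hmem t).2 ((hIcc t).2 ht))]
      · rw [Set.indicator_of_notMem ht,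
          Set.indicator_of_notMem (fun h' => ht ((hIcc t).1 ((hmem t).1 h')))]
    rw [h1, MeasureTheory.integral_indicator measurableSet_Icc,
      MeasureTheory.integral_Icc_eq_integral_Ioc,
      ← intervalIntegral.integral_of_le (by linarith)]
    have h2 := intervalIntegral.smul_integral_comp_mul_add (a := 0) (b := 1)
      (fun t => h ((u : ℂ) * ⟨s, t⟩)) (2 * Real.sin β) (-Real.sin β)
    rw [show 2 * Real.sin β * 0 + -Real.sin β = -Real.sin β by ring,
      show 2 * Real.sin β * 1 + -Real.sin β = Real.sin β by ring] at h2
    rw [← h2]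
    obtain ⟨ψ, hψ⟩ : ∃ ψ, Circle.exp ψ = u := ⟨_, Circle.exp_arg u⟩
    have h3 := hX (ψ - β) (2 * β)
    have h4 : ∀ τ : ℝ, (Circle.exp (ψ - β) : ℂ) * AffineMap.lineMap 1 (Circle.exp (2 * β) : ℂ) τ =
        (u : ℂ) * ⟨s, 2 * Real.sin β * τ + -Real.sin β⟩ := fun τ => by
      have e1 : Circle.exp (2 * β) = Circle.exp β * Circle.exp β := by
        rw [← Circle.exp_add]; ring_nf
      have e2 : (Circle.exp (-β) : ℂ) * Circle.exp β = 1 := by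
        rw [← Circle.coe_mul, ← Circle.exp_add]; simp
      have e3 : (Circle.exp β : ℂ) = ⟨s, Real.sin β⟩ := by
        apply Complex.ext
        · rw [Circle.coe_exp, Complex.exp_ofReal_mul_I_re, hc]
        · rw [Circle.coe_exp, Complex.exp_ofReal_mul_I_im]
      have e4 : (Circle.exp (-β) : ℂ) = ⟨s, -Real.sin β⟩ := by
        apply Complex.ext
        · rw [Circle.coe_exp, Complex.exp_ofReal_mul_I_re, Real.cos_neg, hc]
        · rw [Circle.coe_exp, Complex.exp_ofReal_mul_I_im, Real.sin_neg]
      rw [sub_eq_add_neg, Circle.exp_add, Circle.coe_mul, hψ, mul_assoc]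
      congr 1
      rw [AffineMap.lineMap_apply, vsub_eq_sub, vadd_eq_add, e1, Circle.coe_mul,
        Complex.real_smul]
      calc _ = (1 - (τ : ℂ)) * (Circle.exp (-β) : ℂ) +
            τ * Circle.exp β * ((Circle.exp (-β) : ℂ) * Circle.exp β) := by ring
        _ = _ := by
          rw [e2, e3, e4]
          apply Complex.ext <;> simp <;> ring
    simp only [chordMean, h4] at h3
    rw [h3, smul_zero]

/-- The Fourier slice theorem on the line through `0` in direction `w`: the Fourier transform at `w`
only sees the integrals over the lines orthogonal to `w`. -/
theorem fourier_eq_zero_of_integral_line_eq_zero {H : ℂ → ℂ} (hint : MeasureTheory.Integrable H)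
    (hline : ∀ (u : Circle) (s : ℝ), ∫ t : ℝ, H ((u : ℂ) * ⟨s, t⟩) = 0) :
    FourierTransform.fourier H = 0 := by
  funext w
  obtain ⟨u, hu⟩ : ∃ u : Circle, w = (u : ℂ) * (‖w‖ : ℂ) :=
    ⟨Circle.exp w.arg, by rw [Circle.coe_exp, mul_comm, Complex.norm_mul_exp_arg_mul_I]⟩
  set r := ‖w‖
  rw [Real.fourier_eq, Pi.zero_apply,
    ← ((rotation u).measurePreserving).integral_comp
      (rotation u).toHomeomorph.measurableEmbedding,
    ← Complex.volume_preserving_equiv_real_prod.symm.integral_comp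
      Complex.measurableEquivRealProd.symm.measurableEmbedding]
  have hphase : ∀ p : ℝ × ℝ, inner ℝ ((u : ℂ) * ⟨p.1, p.2⟩) w = p.1 * r := fun p => by
    have := (rotation u).inner_map_map ⟨p.1, p.2⟩ (r : ℂ)
    rw [rotation_apply, rotation_apply, ← hu] at this
    rw [this, Complex.inner]
    simp [mul_comm]
  have hpt : ∀ p : ℝ × ℝ, rotation u (Complex.measurableEquivRealProd.symm p) =
    (u : ℂ) * ⟨p.1, p.2⟩ := fun p => rfl
  simp only [hpt, hphase, Circle.smul_def, smul_eq_mul]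
  have h0 : MeasureTheory.Integrable fun p : ℝ × ℝ => H ((u : ℂ) * ⟨p.1, p.2⟩) := by
    have h1 := ((rotation u).measurePreserving.integrable_comp_emb
      (rotation u).toHomeomorph.measurableEmbedding).2 hint
    exact (Complex.volume_preserving_equiv_real_prod.symm.integrable_comp_emb
      Complex.measurableEquivRealProd.symm.measurableEmbedding).2 h1
  have hint' : MeasureTheory.Integrable fun p : ℝ × ℝ =>
      (Real.fourierChar (-(p.1 * r)) : ℂ) * H ((u : ℂ) * ⟨p.1, p.2⟩) :=
    h0.bdd_mul (c := 1) (Continuous.aestronglyMeasurable (by fun_prop))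
      (Filter.Eventually.of_forall fun p => (Circle.norm_coe _).le)
  rw [MeasureTheory.Measure.volume_eq_prod] at hint' ⊢
  rw [MeasureTheory.integral_prod _ hint']
  refine MeasureTheory.integral_eq_zero_of_ae (Filter.Eventually.of_forall fun s => ?_)
  simp only [MeasureTheory.integral_const_mul, hline, mul_zero, Pi.zero_apply]

/-- Injectivity of the X-ray transform in the disk. The Fourier transform of `h`, extended by zero,
vanishes, and Fourier inversion holds at the points of continuity, in particular in the open disk. -/
theorem eqOn_zero_of_chordMean_eq_zero {h : ℂ → ℝ} (hc : ContinuousOn h (Metric.closedBall 0 1))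
    (hX : ∀ φ α : ℝ, chordMean h φ α = 0) :
    Set.EqOn h 0 (Metric.closedBall 0 1) := by
  set H : ℂ → ℂ := fun z => (((Metric.closedBall (0 : ℂ) 1).indicator h z : ℝ) : ℂ) with hH
  have hint : MeasureTheory.Integrable H := by
    have h0 : MeasureTheory.Integrable ((Metric.closedBall (0 : ℂ) 1).indicator h) := by
      rw [MeasureTheory.integrable_indicator_iff Metric.isClosed_closedBall.measurableSet]
      exact hc.integrableOn_compact (isCompact_closedBall 0 1)
    exact h0.ofReal
  have hF : FourierTransform.fourier H = 0 := by
    refine fourier_eq_zero_of_integral_line_eq_zero hint fun u s => ?_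
    have := integral_ofReal (𝕜 := ℂ) (μ := MeasureTheory.volume)
      (f := fun t : ℝ => (Metric.closedBall (0 : ℂ) 1).indicator h ((u : ℂ) * ⟨s, t⟩))
    rw [integral_line_indicator_eq_zero hX] at this
    exact this.trans Complex.ofReal_zero
  have hball : Set.EqOn h 0 (Metric.ball 0 1) := by
    intro z hz
    have hcl := Metric.ball_subset_closedBall hz
    have hev : H =ᶠ[𝓝 z] fun z => (h z : ℂ) := by
      filter_upwards [Metric.isOpen_ball.mem_nhds hz] with y hy
      rw [hH]
      simp only
      rw [Set.indicator_of_mem (Metric.ball_subset_closedBall hy)]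
    have hcont : ContinuousAt H z := by
      refine ContinuousAt.congr ?_ hev.symm
      exact Complex.continuous_ofReal.continuousAt.comp
        (hc.continuousAt (Filter.mem_of_superset (Metric.isOpen_ball.mem_nhds hz)
          Metric.ball_subset_closedBall))
    have := hint.fourierInv_fourier_eq (by rw [hF]; exact MeasureTheory.integrable_zero _ _ _) hcont
    rw [hF, hev.eq_of_nhds, Real.fourierInv_eq] at this
    simp only [Pi.zero_apply, smul_zero, MeasureTheory.integral_zero] at this
    exact_mod_cast this.symm
  rw [← closure_ball (0 : ℂ) one_ne_zero] at hc ⊢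
  exact hball.of_subset_closure hc continuousOn_const subset_closure subset_rfl

/-! ### Trigonometric series and angular derivatives -/

/-- Cauchy–Schwarz turns the weighted `ℓ²` bounds into weighted `ℓ¹` bounds, at the price of one
power of `k`. -/
theorem SSharpWith.summable_tsum_le {M : ℕ → ℝ} {ρ : ℝ} {a : ℕ → ℝ} (h : SSharpWith M ρ a)
    (n : ℕ) :
    Summable (fun k : ℕ => ((k : ℝ) + 1) ^ n * |a (k + 1)|) ∧
      ∑' k : ℕ, ((k : ℝ) + 1) ^ n * |a (k + 1)| ≤
        √(M (n + 1) * ρ ^ (n + 1)) * √(∑' k : ℕ, 1 / ((k : ℝ) + 1) ^ 2) := by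
  have hs2 : Summable fun k : ℕ => 1 / ((k : ℝ) + 1) ^ 2 := by
    have := (summable_nat_add_iff (f := fun k : ℕ => 1 / (k : ℝ) ^ 2) 1).2
      (Real.summable_one_div_nat_pow.2 one_lt_two)
    simpa using this
  obtain ⟨hs1, hle⟩ := h (n + 1)
  have hnn : ∀ k : ℕ, 0 ≤ ((k : ℝ) + 1) ^ n * |a (k + 1)| := fun k => by positivity
  have hpart : ∀ K, ∑ k ∈ Finset.range K, ((k : ℝ) + 1) ^ n * |a (k + 1)| ≤
      √(M (n + 1) * ρ ^ (n + 1)) * √(∑' k : ℕ, 1 / ((k : ℝ) + 1) ^ 2) := by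
    intro K
    calc ∑ k ∈ Finset.range K, ((k : ℝ) + 1) ^ n * |a (k + 1)| =
          ∑ k ∈ Finset.range K, (((k : ℝ) + 1) ^ (n + 1) * |a (k + 1)|) * (1 / ((k : ℝ) + 1)) :=
          Finset.sum_congr rfl fun k _ => by
            have : (k : ℝ) + 1 ≠ 0 := by positivity
            rw [pow_succ]
            field_simp
      _ ≤ √(∑ k ∈ Finset.range K, (((k : ℝ) + 1) ^ (n + 1) * |a (k + 1)|) ^ 2) *
          √(∑ k ∈ Finset.range K, (1 / ((k : ℝ) + 1)) ^ 2) := Real.sum_mul_le_sqrt_mul_sqrt _ _ _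
      _ ≤ _ := by
        gcongr
        · refine le_trans ?_ hle
          refine le_trans (le_of_eq ?_) (hs1.sum_le_tsum (Finset.range K) fun k _ => by positivity)
          exact Finset.sum_congr rfl fun k _ => by rw [mul_pow, ← pow_mul, mul_comm 2]
        · refine le_trans (le_of_eq ?_) (hs2.sum_le_tsum (Finset.range K) fun k _ => by positivity)
          exact Finset.sum_congr rfl fun k _ => by rw [div_pow, one_pow]
  exact ⟨summable_of_sum_range_le hnn hpart, Real.tsum_le_of_sum_range_le hnn hpart⟩

/-- The `n`-th derivative of the `k`-th term `a k * cos (k x) + b k * sin (k x)` of a trigonometric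
series; each differentiation shifts the phase by `π / 2`. -/
noncomputable def trigTerm (a b : ℕ → ℝ) (n k : ℕ) (x : ℝ) : ℝ :=
  (k : ℝ) ^ n * (a k * Real.cos (k * x + n * (Real.pi / 2)) +
    b k * Real.sin (k * x + n * (Real.pi / 2)))

theorem hasDerivAt_trigTerm (a b : ℕ → ℝ) (n k : ℕ) (x : ℝ) :
    HasDerivAt (trigTerm a b n k) (trigTerm a b (n + 1) k x) x := by
  have h0 : HasDerivAt (fun x : ℝ => (k : ℝ) * x + n * (Real.pi / 2)) k x := by
    simpa using ((hasDerivAt_id x).const_mul (k : ℝ)).add_const ((n : ℝ) * (Real.pi / 2))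
  have h := ((h0.cos.const_mul (a k)).add (h0.sin.const_mul (b k))).const_mul ((k : ℝ) ^ n)
  refine h.congr_deriv ?_
  rw [trigTerm, show (k : ℝ) * x + ((n + 1 : ℕ) : ℝ) * (Real.pi / 2) =
    (k * x + n * (Real.pi / 2)) + Real.pi / 2 by push_cast; ring, Real.cos_add_pi_div_two,
    Real.sin_add_pi_div_two]
  ring

theorem abs_trigTerm_le (a b : ℕ → ℝ) (n k : ℕ) (x : ℝ) :
    |trigTerm a b n k x| ≤ (k : ℝ) ^ n * |a k| + (k : ℝ) ^ n * |b k| := by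
  rw [trigTerm, abs_mul, abs_of_nonneg (by positivity : (0 : ℝ) ≤ (k : ℝ) ^ n), ← mul_add]
  gcongr
  refine (abs_add_le _ _).trans (add_le_add ?_ ?_)
  · rw [abs_mul]; exact mul_le_of_le_one_right (abs_nonneg _) (Real.abs_cos_le_one _)
  · rw [abs_mul]; exact mul_le_of_le_one_right (abs_nonneg _) (Real.abs_sin_le_one _)

/-- A function of class `C^#(M)` is smooth, with derivatives controlled by `M`. The function itself
is left out of the bound because the class does not constrain the constant term of the series. -/
theorem CSharpWith.iteratedDeriv_bound {M : ℕ → ℝ} {ρ : ℝ} {g : ℝ → ℝ} (h : CSharpWith M ρ g)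
    (n : ℕ) (x : ℝ) :
    HasDerivAt (iteratedDeriv n g) (iteratedDeriv (n + 1) g x) x ∧
      |iteratedDeriv (n + 1) g x| ≤ 2 * √(∑' k : ℕ, 1 / ((k : ℝ) + 1) ^ 2) *
        √(M (n + 2) * ρ ^ (n + 2)) := by
  obtain ⟨a, b, ha, hb, hg⟩ := h
  have hsum : ∀ n : ℕ, Summable fun k : ℕ => (k : ℝ) ^ n * |a k| + (k : ℝ) ^ n * |b k| := by
    intro n
    refine (summable_nat_add_iff 1).1 ?_
    simpa using (ha.summable_tsum_le n).1.add (hb.summable_tsum_le n).1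
  have hW : ∀ n x, HasDerivAt (fun x => ∑' k, trigTerm a b n k x)
      (∑' k, trigTerm a b (n + 1) k x) x := fun n x =>
    hasDerivAt_tsum (y₀ := 0) (hsum (n + 1)) (fun k y => hasDerivAt_trigTerm a b n k y)
      (fun k y => abs_trigTerm_le a b (n + 1) k y)
      (Summable.of_norm_bounded (hsum n) fun k => abs_trigTerm_le a b n k 0) x
  have hgW : ∀ n, iteratedDeriv n g = fun x => ∑' k, trigTerm a b n k x := by
    intro n
    induction n with
    | zero =>
      funext x
      have h1 : Summable fun k => trigTerm a b 0 k x :=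
        Summable.of_norm_bounded (hsum 0) fun k => abs_trigTerm_le a b 0 k x
      refine tendsto_nhds_unique (hg.tendsto_at x) ?_
      have := h1.hasSum.tendsto_sum_nat
      simpa [trigTerm] using this
    | succ n ih =>
      rw [iteratedDeriv_succ, ih]
      exact funext fun x => (hW n x).deriv
  refine ⟨?_, ?_⟩
  · rw [hgW, hgW]
    exact hW n x
  · rw [hgW]
    have h1 := tsum_of_norm_bounded (hsum (n + 1)).hasSum
      (f := fun k => trigTerm a b (n + 1) k x) (fun k => abs_trigTerm_le a b (n + 1) k x)
    rw [Real.norm_eq_abs] at h1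
    refine h1.trans ?_
    have ha' := ha.summable_tsum_le (n + 1)
    have hb' := hb.summable_tsum_le (n + 1)
    rw [(hsum (n + 1)).tsum_eq_zero_add]
    simp only [Nat.cast_zero, ne_eq, Nat.add_eq_zero_iff, one_ne_zero, and_false,
      not_false_eq_true, zero_pow, zero_mul, add_zero, zero_add, Nat.cast_add, Nat.cast_one]
    rw [ha'.1.tsum_add hb'.1]
    linarith [ha'.2, hb'.2]

/-- The factor `log (1 / δ)` is eventually at least `1`, so the modulus of continuity itself tends to zero. -/
theorem DiniLipschitzOn.continuousOn {g : ℂ → ℝ} {s : Set ℂ} (h : DiniLipschitzOn g s) :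
    ContinuousOn g s := by
  refine EMetric.continuousOn_iff.2 fun x hx ε hε => ?_
  have h1 : ∀ᶠ δ : ℝ in 𝓝[>] 0, 1 ≤ Real.log (1 / δ) := by
    have : Filter.Tendsto (fun δ : ℝ => Real.log (1 / δ)) (𝓝[>] 0) Filter.atTop := by
      simpa only [one_div, Function.comp_def] using
        Real.tendsto_log_atTop.comp tendsto_inv_nhdsGT_zero
    exact this.eventually_ge_atTop 1
  obtain ⟨δ, ⟨hδε, hδ1⟩, hδ0⟩ :=
    ((h.eventually_lt_const hε).and h1 |>.and self_mem_nhdsWithin).exists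
  refine ⟨ENNReal.ofReal δ, ENNReal.ofReal_pos.2 hδ0, fun y hy hyx => ?_⟩
  have hdist : dist y x ≤ δ := by
    rw [edist_dist] at hyx
    exact ((ENNReal.ofReal_lt_ofReal_iff hδ0).1 hyx).le
  have hle : edist (g y) (g x) ≤ modulusOfContinuity g s δ :=
    le_iSup₂_of_le y hy (le_iSup₂_of_le x hx (le_iSup_of_le hdist le_rfl))
  refine lt_of_le_of_lt (hle.trans ?_) hδε
  exact le_mul_of_one_le_right' (by simpa using ENNReal.ofReal_le_ofReal hδ1)

/-- `D n` is the `n`-th angular derivative of `D 0` away from the origin, is continuous in the closed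
disk, and satisfies on each annulus `R ≤ |x| ≤ 1` the bounds that follow from the class `C^#(𝓜 R)`.
Since the constants may depend on `D`, these conditions are stable under subtraction. -/
structure AngularJet (𝓜 : ℝ → ℕ → ℝ) (D : ℕ → ℂ → ℝ) : Prop where
  continuousOn : ∀ n, ContinuousOn (D n) (Metric.closedBall 0 1)
  hasDerivAt : ∀ n, ∀ x ∈ Metric.closedBall (0 : ℂ) 1, x ≠ 0 →
    HasDerivAt (fun θ : ℝ => D n ((Circle.exp θ : ℂ) * x)) (D (n + 1) x) 0
  bound : ∀ R ∈ Set.Ioc (0 : ℝ) 1, ∃ C ρ : ℝ, 0 < C ∧ 0 < ρ ∧ ∀ n x, R ≤ ‖x‖ → ‖x‖ ≤ 1 →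
    |D n x| ≤ C * √(𝓜 R (n + 1) * ρ ^ (n + 1))

theorem AngularJet.sub {𝓜 : ℝ → ℕ → ℝ} (h𝓜 : ∀ R ∈ Set.Ioc (0 : ℝ) 1, IsQuasianalyticWeight (𝓜 R))
    {D D' : ℕ → ℂ → ℝ} (h : AngularJet 𝓜 D) (h' : AngularJet 𝓜 D') :
    AngularJet 𝓜 (D - D') where
  continuousOn n := (h.continuousOn n).sub (h'.continuousOn n)
  hasDerivAt n x hx hx0 := (h.hasDerivAt n x hx hx0).sub (h'.hasDerivAt n x hx hx0)
  bound R hR := by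
    obtain ⟨C, ρ, hC, hρ, hb⟩ := h.bound R hR
    obtain ⟨C', ρ', hC', hρ', hb'⟩ := h'.bound R hR
    refine ⟨C + C', max ρ ρ', by positivity, lt_max_of_lt_left hρ, fun n x hx hx1 => ?_⟩
    have hpos := ((h𝓜 R hR).pos (n + 1)).le
    have h1 : C * √(𝓜 R (n + 1) * ρ ^ (n + 1)) ≤
        C * √(𝓜 R (n + 1) * (max ρ ρ') ^ (n + 1)) := by
      gcongr; exact le_max_left _ _
    have h2 : C' * √(𝓜 R (n + 1) * ρ' ^ (n + 1)) ≤
        C' * √(𝓜 R (n + 1) * (max ρ ρ') ^ (n + 1)) := by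
      gcongr; exact le_max_right _ _
    have h3 := abs_sub (D n x) (D' n x)
    simp only [Pi.sub_apply]
    rw [add_mul]
    linarith [hb n x hx hx1, hb' n x hx hx1]

theorem UniformlyInClasses.angularJet {𝓜 : ℝ → ℕ → ℝ}
    (h𝓜 : ∀ R ∈ Set.Ioc (0 : ℝ) 1, IsQuasianalyticWeight (𝓜 R)) {f : ℂ → ℝ}
    (hf : UniformlyInClasses 𝓜 f) (hD : AngularDerivativesDiniLipschitz f) :
    AngularJet 𝓜 (fun n => angularDeriv n f) := by
  obtain ⟨hfc, hf⟩ := hf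
  have hexp : ∀ θ φ : ℝ, ∀ r : ℂ, (Circle.exp θ : ℂ) * (r * (Circle.exp φ : ℂ)) =
      r * (Circle.exp (θ + φ) : ℂ) := fun θ φ r => by
    rw [Circle.exp_add, Circle.coe_mul]; ring
  have hpolar : ∀ x : ℂ, x = (‖x‖ : ℂ) * (Circle.exp x.arg : ℂ) := fun x => by
    rw [Circle.coe_exp, Complex.norm_mul_exp_arg_mul_I]
  have hang : ∀ (n : ℕ) (r φ : ℝ), angularDeriv n f (r * (Circle.exp φ : ℂ)) =
      iteratedDeriv n (fun θ : ℝ => f ((r : ℂ) * (Circle.exp θ : ℂ))) φ := fun n r φ => by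
    rw [angularDeriv]
    simp only [hexp]
    have := congrFun (iteratedDeriv_comp_add_const n
      (fun θ : ℝ => f ((r : ℂ) * (Circle.exp θ : ℂ))) φ) 0
    simpa using this
  refine ⟨fun n => (hD n).continuousOn, fun n x hx hx0 => ?_, fun R hR => ?_⟩
  · rw [mem_closedBall_zero_iff] at hx
    obtain ⟨ρ, -, h⟩ := hf ‖x‖ ⟨norm_pos_iff.2 hx0, hx⟩
    have h1 := ((h ‖x‖ ⟨le_rfl, hx⟩).iteratedDeriv_bound n x.arg).1
    rw [← hang, ← hpolar, ← zero_add x.arg] at h1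
    refine (h1.comp_add_const 0 x.arg).congr_of_eventuallyEq ?_
    refine Filter.Eventually.of_forall fun θ => ?_
    simp only
    rw [← hang, ← hexp, ← hpolar]
  · obtain ⟨ρ, hρ, h⟩ := hf R hR
    -- The bound of order `0` comes from compactness, the others from the class.
    obtain ⟨B, hB⟩ := (isCompact_closedBall (0 : ℂ) 1).exists_bound_of_continuousOn hfc
    have hB0 : 0 ≤ B := (norm_nonneg _).trans (hB 0 (by simp))
    set m := √(𝓜 R 1 * ρ ^ 1)
    have hm : 0 < m := Real.sqrt_pos.2 (mul_pos ((h𝓜 R hR).pos 1) (pow_pos hρ 1))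
    set S := √(∑' k : ℕ, 1 / ((k : ℝ) + 1) ^ 2)
    have hS : 0 ≤ S := Real.sqrt_nonneg _
    refine ⟨1 + 2 * S + B / m, ρ, by positivity, hρ, fun n x hx hx1 => ?_⟩
    cases n with
    | zero =>
      have : B = B / m * m := (div_mul_cancel₀ B hm.ne').symm
      have h1 := hB x (mem_closedBall_zero_iff.2 hx1)
      have h2 : angularDeriv 0 f x = f x := by simp [angularDeriv]
      rw [Real.norm_eq_abs] at h1
      rw [h2]
      change |f x| ≤ (1 + 2 * S + B / m) * m
      nlinarith [mul_nonneg hS hm.le]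
    | succ n =>
      have h1 := ((h ‖x‖ ⟨hx, hx1⟩).iteratedDeriv_bound n x.arg).2
      rw [← hang, ← hpolar] at h1
      refine h1.trans ?_
      gcongr
      have : 0 ≤ B / m := by positivity
      linarith

/-! ### Means over chords -/

theorem norm_chord_le (α : ℝ) {s : ℝ} (hs : s ∈ Set.Icc (0 : ℝ) 1) :
    ‖AffineMap.lineMap (1 : ℂ) (Circle.exp α : ℂ) s‖ ≤ 1 :=
  mem_closedBall_zero_iff.1 <| (convex_closedBall (0 : ℂ) 1).lineMap_mem
    (by simp) (mem_closedBall_zero_iff.2 (Circle.norm_coe _).le) hs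

theorem chord_mem (φ α : ℝ) {s : ℝ} (hs : s ∈ Set.Icc (0 : ℝ) 1) :
    (Circle.exp φ : ℂ) * AffineMap.lineMap 1 (Circle.exp α : ℂ) s ∈ Metric.closedBall (0 : ℂ) 1 := by
  rw [mem_closedBall_zero_iff, norm_mul, Circle.norm_coe, one_mul]
  exact norm_chord_le α hs

theorem continuousOn_chord {h : ℂ → ℝ} (hc : ContinuousOn h (Metric.closedBall 0 1)) (φ α : ℝ) :
    ContinuousOn (fun s : ℝ => h ((Circle.exp φ : ℂ) * AffineMap.lineMap 1 (Circle.exp α : ℂ) s))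
      (Set.Icc 0 1) :=
  hc.comp (continuous_const.mul AffineMap.lineMap_continuous).continuousOn
    fun _ hs => chord_mem φ α hs

theorem intervalIntegrable_chord {h : ℂ → ℝ} (hc : ContinuousOn h (Metric.closedBall 0 1))
    (φ α : ℝ) : IntervalIntegrable
      (fun s : ℝ => h ((Circle.exp φ : ℂ) * AffineMap.lineMap 1 (Circle.exp α : ℂ) s))
      MeasureTheory.volume 0 1 :=
  ContinuousOn.intervalIntegrable (by rw [Set.uIcc_of_le zero_le_one]; exact continuousOn_chord hc φ α)

theorem chordMean_sub {h k : ℂ → ℝ} (hh : ContinuousOn h (Metric.closedBall 0 1))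
    (hk : ContinuousOn k (Metric.closedBall 0 1)) (φ α : ℝ) :
    chordMean (h - k) φ α = chordMean h φ α - chordMean k φ α :=
  intervalIntegral.integral_sub (intervalIntegrable_chord hh φ α) (intervalIntegrable_chord hk φ α)

theorem continuous_chordMean {h : ℂ → ℝ} (hc : ContinuousOn h (Metric.closedBall 0 1)) :
    Continuous fun p : ℝ × ℝ => chordMean h p.1 p.2 := by
  -- Extend `h` continuously to the plane, by the radial retraction onto the disk.
  have hmax : ∀ z : ℂ, max 1 ‖z‖ ≠ 0 := fun z => (lt_max_of_lt_left one_pos).ne'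
  have hk : Continuous fun z : ℂ => h ((max 1 ‖z‖)⁻¹ • z) := by
    refine hc.comp_continuous ?_ fun z => ?_
    · exact ((continuous_const.max continuous_norm).inv₀ hmax).smul continuous_id
    · rw [mem_closedBall_zero_iff, norm_smul, norm_inv, Real.norm_of_nonneg (by positivity),
        inv_mul_le_one₀ (by positivity)]
      exact le_max_right _ _
  have heq : ∀ p : ℝ × ℝ, chordMean h p.1 p.2 =
      chordMean (fun z : ℂ => h ((max 1 ‖z‖)⁻¹ • z)) p.1 p.2 := fun p => by
    refine intervalIntegral.integral_congr fun s hs => ?_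
    rw [Set.uIcc_of_le zero_le_one] at hs
    have := mem_closedBall_zero_iff.1 (chord_mem p.1 p.2 hs)
    simp only
    rw [max_eq_left this, inv_one, one_smul]
  simp only [heq]
  refine intervalIntegral.continuous_parametric_intervalIntegral_of_continuous' ?_ 0 1
  refine hk.comp ?_
  simp only [AffineMap.lineMap_apply, vsub_eq_sub, vadd_eq_add]
  fun_prop

theorem periodic_chordMean (h : ℂ → ℝ) (α : ℝ) :
    Function.Periodic (fun φ => chordMean h φ α) (2 * Real.pi) := fun φ => by
  simp only [chordMean, Circle.periodic_exp φ]

/-- A chord that is not a diameter stays away from the origin. -/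
theorem exists_le_norm_chord {α : ℝ} (hα : Circle.exp α ≠ Circle.exp Real.pi) :
    ∃ R ∈ Set.Ioc (0 : ℝ) 1, ∀ s ∈ Set.Icc (0 : ℝ) 1,
      R ≤ ‖AffineMap.lineMap (1 : ℂ) (Circle.exp α : ℂ) s‖ := by
  obtain ⟨s₀, hs₀, hmin⟩ := isCompact_Icc.exists_isMinOn (Set.nonempty_Icc.2 zero_le_one)
    (f := fun s : ℝ => ‖AffineMap.lineMap (1 : ℂ) (Circle.exp α : ℂ) s‖)
    AffineMap.lineMap_continuous.norm.continuousOn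
  refine ⟨_, ⟨norm_pos_iff.2 fun h0 => hα ?_, norm_chord_le α hs₀⟩, fun s hs => hmin hs⟩
  have h1 : (s₀ : ℂ) * (Circle.exp α : ℂ) = s₀ - 1 := by
    rw [AffineMap.lineMap_apply, vsub_eq_sub, vadd_eq_add, Complex.real_smul] at h0
    linear_combination h0
  have h2 := congrArg norm h1
  rw [norm_mul, Circle.norm_coe, mul_one, show (s₀ : ℂ) - 1 = ((s₀ - 1 : ℝ) : ℂ) by push_cast; ring,
    Complex.norm_real, Complex.norm_real, Real.norm_of_nonneg hs₀.1,
    Real.norm_of_nonpos (by linarith [hs₀.2])] at h2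
  -- A chord meets the origin only at its midpoint.
  have h3 : s₀ = 1 / 2 := by linarith
  apply Subtype.ext
  rw [show ((Circle.exp Real.pi : Circle) : ℂ) = -1 by rw [Circle.coe_exp, Complex.exp_pi_mul_I]]
  rw [h3] at h1
  have h4 : ((1 / 2 : ℝ) : ℂ) = 1 / 2 := by norm_num
  rw [h4] at h1
  linear_combination 2 * h1

theorem AngularJet.hasDerivAt_mul {𝓜 : ℝ → ℕ → ℝ} {D : ℕ → ℂ → ℝ} (h : AngularJet 𝓜 D) (n : ℕ)
    {c : ℂ} (hc0 : c ≠ 0) (hc1 : ‖c‖ ≤ 1) (φ : ℝ) :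
    HasDerivAt (fun φ : ℝ => D n ((Circle.exp φ : ℂ) * c)) (D (n + 1) ((Circle.exp φ : ℂ) * c)) φ := by
  have h1 := h.hasDerivAt n ((Circle.exp φ : ℂ) * c)
    (by rw [mem_closedBall_zero_iff, norm_mul, Circle.norm_coe, one_mul]; exact hc1)
    (mul_ne_zero (Circle.coe_ne_zero _) hc0)
  rw [← sub_self φ] at h1
  refine (h1.comp_sub_const φ φ).congr_of_eventuallyEq (Filter.Eventually.of_forall fun θ => ?_)
  simp only
  rw [← mul_assoc, ← Circle.coe_mul, ← Circle.exp_add, sub_add_cancel]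

/-- The chord means with a fixed opening angle inherit the derivatives and the bounds from the
function: the chords of that opening angle all lie in one annulus. -/
theorem AngularJet.hasDerivAt_chordMean {𝓜 : ℝ → ℕ → ℝ} {D : ℕ → ℂ → ℝ} (h : AngularJet 𝓜 D) {α : ℝ}
    (hα : Circle.exp α ≠ Circle.exp Real.pi) :
    (∀ n φ, HasDerivAt (fun φ => chordMean (D n) φ α) (chordMean (D (n + 1)) φ α) φ) ∧
      ∃ R ∈ Set.Ioc (0 : ℝ) 1, ∃ C ρ : ℝ, 0 < C ∧ 0 < ρ ∧ ∀ n φ,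
        |chordMean (D n) φ α| ≤ C * √(𝓜 R (n + 1) * ρ ^ (n + 1)) := by
  obtain ⟨R, hR, hRle⟩ := exists_le_norm_chord hα
  obtain ⟨C, ρ, hC, hρ, hb⟩ := h.bound R hR
  have hb' : ∀ n φ, ∀ s ∈ Set.uIoc (0 : ℝ) 1,
      ‖D n ((Circle.exp φ : ℂ) * AffineMap.lineMap 1 (Circle.exp α : ℂ) s)‖ ≤
        C * √(𝓜 R (n + 1) * ρ ^ (n + 1)) := fun n φ s hs => by
    rw [Set.uIoc_of_le zero_le_one] at hs
    have hs' := Set.Ioc_subset_Icc_self hs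
    refine hb n _ ?_ ?_ <;> rw [norm_mul, Circle.norm_coe, one_mul]
    · exact hRle s hs'
    · exact norm_chord_le α hs'
  refine ⟨fun n φ => ?_, R, hR, C, ρ, hC, hρ, fun n φ => ?_⟩
  · refine (intervalIntegral.hasDerivAt_integral_of_dominated_loc_of_deriv_le
      (F := fun φ s => D n ((Circle.exp φ : ℂ) * AffineMap.lineMap 1 (Circle.exp α : ℂ) s))
      (F' := fun φ s => D (n + 1) ((Circle.exp φ : ℂ) * AffineMap.lineMap 1 (Circle.exp α : ℂ) s))
      (bound := fun _ => C * √(𝓜 R (n + 1 + 1) * ρ ^ (n + 1 + 1)))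
      Filter.univ_mem (Filter.Eventually.of_forall fun φ => ?_)
      (intervalIntegrable_chord (h.continuousOn n) φ α) ?_ ?_ ?_ ?_).2
    · exact (intervalIntegrable_chord (h.continuousOn n) φ α).def'.aestronglyMeasurable
    · exact (intervalIntegrable_chord (h.continuousOn (n + 1)) φ α).def'.aestronglyMeasurable
    · exact Filter.Eventually.of_forall fun s hs φ _ => hb' (n + 1) φ s hs
    · exact intervalIntegrable_const
    · refine Filter.Eventually.of_forall fun s hs φ _ => ?_
      rw [Set.uIoc_of_le zero_le_one] at hs
      have hs' := Set.Ioc_subset_Icc_self hs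
      exact h.hasDerivAt_mul n (norm_pos_iff.1 (hR.1.trans_le (hRle s hs'))) (norm_chord_le α hs') φ
  · have h1 := intervalIntegral.norm_integral_le_of_norm_le_const (hb' n φ)
    rwa [sub_zero, abs_one, mul_one] at h1

/-! ### Vanishing of the chord means -/

/-- The bounds of an `AngularJet` satisfy the hypotheses of the Denjoy–Carleman theorem. -/
theorem IsQuasianalyticWeight.sqrt {M : ℕ → ℝ} (h : IsQuasianalyticWeight M) {K ρ : ℝ} (hK : 0 < K)
    (hρ : 0 < ρ) :
    (∀ n, 0 < K * √(M (n + 1) * ρ ^ (n + 1))) ∧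
      (Monotone fun n => (K * √(M (n + 1 + 1) * ρ ^ (n + 1 + 1))) / (K * √(M (n + 1) * ρ ^ (n + 1)))) ∧
      ¬ Summable fun n => (K * √(M (n + 1) * ρ ^ (n + 1))) / (K * √(M (n + 1 + 1) * ρ ^ (n + 1 + 1))) := by
  have hM := h.pos
  refine ⟨fun n => ?_, ?_, fun hs => h.diverges ?_⟩
  · have := hM (n + 1); positivity
  · have e : ∀ n, (K * √(M (n + 1 + 1) * ρ ^ (n + 1 + 1))) / (K * √(M (n + 1) * ρ ^ (n + 1))) =
        √(M (n + 1 + 1) / M (n + 1) * ρ) := fun n => by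
      have h1 := hM (n + 1)
      rw [mul_div_mul_left _ _ hK.ne', ← Real.sqrt_div' _ (by positivity)]
      congr 1
      rw [pow_succ ρ (n + 1)]
      field_simp
    simp only [e]
    refine monotone_nat_of_le_succ fun n => Real.sqrt_le_sqrt ?_
    have h1 := hM (n + 1); have h2 := hM (n + 1 + 1); have h3 := hM (n + 1 + 2)
    have h4 := h.log_convex (n + 1)
    rw [← Real.log_mul h1.ne' h3.ne', two_mul, ← Real.log_mul h2.ne' h2.ne',
      Real.log_le_log_iff (by positivity) (by positivity)] at h4
    gcongr ?_ * ρ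
    rw [div_le_div_iff₀ h1 h2]
    linarith
  · have e : ∀ n, (K * √(M (n + 1) * ρ ^ (n + 1))) / (K * √(M (n + 1 + 1) * ρ ^ (n + 1 + 1))) =
        √(M (n + 1) / M (n + 1 + 1)) * √(ρ⁻¹) := fun n => by
      have h1 := hM (n + 1); have h2 := hM (n + 1 + 1)
      rw [mul_div_mul_left _ _ hK.ne', ← Real.sqrt_div' _ (by positivity),
        ← Real.sqrt_mul' _ (by positivity)]
      congr 1
      rw [pow_succ ρ (n + 1)]
      field_simp
    simp only [e] at hs
    rw [summable_mul_right_iff (Real.sqrt_pos.2 (inv_pos.2 hρ)).ne'] at hs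
    exact (summable_nat_add_iff (f := fun n => √(M n / M (n + 1))) 1).1 hs

theorem eq_const_of_periodic {F : ℝ → ℝ} (hF : Continuous F) {a b : ℝ} (hab : Irrational (a / b))
    (ha : Function.Periodic F a) (hb : Function.Periodic F b) (x : ℝ) : F x = F 0 := by
  have hd := dense_addSubgroupClosure_pair_iff.2 hab
  refine congrFun (Continuous.ext_on (g := fun _ => F 0) hd hF continuous_const fun t ht => ?_) x
  have hper : Function.Periodic F t := by
    induction ht using AddSubgroup.closure_induction with
    | mem t ht =>
      rcases ht with rfl | rfl
      exacts [ha, hb]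
    | zero => intro x; simp
    | add s t _ _ hs ht => exact hs.add_period ht
    | neg t _ ht => exact ht.neg
  simpa using hper 0

/-- Dirichlet approximation makes `n α` close to a multiple of `2π`, so that `e^{iι}` and
`e^{i(ι + nα)}` both lie in `E` for an open set of `ι`. -/
theorem exists_pos_nat_near_period {E : Set Circle} (hE : IsOpen E) (hne : E.Nonempty) (α : ℝ) :
    ∃ n : ℕ, 0 < n ∧ ∃ ι₀ : ℝ, ∀ᶠ ι in 𝓝 ι₀, Circle.exp ι ∈ E ∧ Circle.exp (ι + n * α) ∈ E := by
  obtain ⟨z, hz⟩ := hne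
  obtain ⟨ι₀, hι₀⟩ : ∃ ι₀, Circle.exp ι₀ = z := ⟨_, Circle.exp_arg z⟩
  have hmem : Circle.exp ⁻¹' E ∈ 𝓝 ι₀ :=
    (hE.preimage Circle.exp.continuous).mem_nhds (by rw [Set.mem_preimage, hι₀]; exact hz)
  obtain ⟨ε, hε, hball⟩ := Metric.mem_nhds_iff.1 hmem
  obtain ⟨N, hN⟩ := exists_nat_one_div_lt (show 0 < ε / 2 / (2 * Real.pi) by positivity)
  obtain ⟨j, k, hk, -, hjk⟩ := Real.exists_int_int_abs_mul_sub_le (α / (2 * Real.pi)) N.succ_pos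
  lift k to ℕ using hk.le
  refine ⟨k, by exact_mod_cast hk, ι₀, ?_⟩
  have hclose : |k * α - j * (2 * Real.pi)| < ε / 2 := by
    have h1 : |(k : ℝ) * (α / (2 * Real.pi)) - j| < ε / 2 / (2 * Real.pi) := by
      refine lt_of_le_of_lt hjk (lt_of_le_of_lt ?_ hN)
      push_cast
      gcongr
      linarith
    have h2 : k * α - j * (2 * Real.pi) = (k * (α / (2 * Real.pi)) - j) * (2 * Real.pi) := by
      field_simp
    rw [h2, abs_mul, abs_of_pos Real.two_pi_pos]
    exact (lt_div_iff₀ Real.two_pi_pos).1 h1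
  filter_upwards [Metric.ball_mem_nhds ι₀ (half_pos hε)] with ι hι
  rw [Metric.mem_ball, Real.dist_eq] at hι
  refine ⟨hball ?_, ?_⟩
  · rw [Metric.mem_ball, Real.dist_eq]; linarith
  · have h1 : Circle.exp (ι + k * α) = Circle.exp (ι + (k * α - j * (2 * Real.pi))) := by
      rw [← add_sub_assoc]
      exact (Circle.periodic_exp.sub_int_mul_eq j).symm
    rw [h1]
    refine hball (?_ : _ ∈ Metric.ball ι₀ ε)
    rw [Metric.mem_ball, Real.dist_eq]
    rw [abs_lt] at *
    constructor <;> linarith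

/-- The chord means vanish for every opening angle that is an irrational multiple of `2π`. The number
of segments and the opening angle stay fixed, and only the initial point of the rays varies. -/
theorem AngularJet.chordMean_eq_zero_of_irrational {𝓜 : ℝ → ℕ → ℝ}
    (h𝓜 : ∀ R ∈ Set.Ioc (0 : ℝ) 1, IsQuasianalyticWeight (𝓜 R)) {D : ℕ → ℂ → ℝ}
    (hD : AngularJet 𝓜 D) {E : Set Circle} (hE : IsOpen E) (hne : E.Nonempty)
    (hray : ∀ γ : BrokenRay E, ∑ l ∈ Finset.range γ.n, chordMean (D 0) (γ.ι + l * γ.α) γ.α = 0)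
    {α : ℝ} (hα : Irrational (α / (2 * Real.pi))) (φ : ℝ) :
    chordMean (D 0) φ α = 0 := by
  have hπ := Real.two_pi_pos
  have hαπ : Circle.exp α ≠ Circle.exp Real.pi := fun h => by
    obtain ⟨m, hm⟩ := Circle.exp_eq_exp.1 h
    refine hα ⟨1 / 2 + m, ?_⟩
    rw [hm]
    push_cast
    field_simp
  have hsin : Real.sin (α / 2) ≠ 0 := fun h => by
    obtain ⟨m, hm⟩ := Real.sin_eq_zero_iff.1 h
    refine hα ⟨m, ?_⟩
    rw [show α = 2 * (m * Real.pi) by linarith]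
    push_cast
    field_simp
  obtain ⟨hder, R, hR, C, ρ, hC, hρ, hbound⟩ := hD.hasDerivAt_chordMean hαπ
  obtain ⟨n, hn, ι₀, hι₀⟩ := exists_pos_nat_near_period hE hne α
  set F : ℕ → ℝ → ℝ := fun j φ => chordMean (D j) φ α with hF
  have hFper : ∀ j, Function.Periodic (F j) (2 * Real.pi) := fun j => periodic_chordMean (D j) α
  set G : ℕ → ℝ → ℝ := fun j φ => ∑ l ∈ Finset.range n, F j (φ + l * α) with hGdef
  have hG : ∀ j φ, HasDerivAt (G j) (G (j + 1) φ) φ := fun j φ =>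
    HasDerivAt.fun_sum fun l _ => (hder j (φ + l * α)).comp_add_const φ (l * α)
  have hGb : ∀ j φ, |G j φ| ≤ (n * C) * √(𝓜 R (j + 1) * ρ ^ (j + 1)) := fun j φ => by
    refine (Finset.abs_sum_le_sum_abs _ _).trans ?_
    refine (Finset.sum_le_card_nsmul _ (fun l : ℕ => |F j (φ + l * α)|) _
      fun l _ => hbound j (φ + l * α)).trans (le_of_eq ?_)
    rw [Finset.card_range, nsmul_eq_mul, mul_assoc]
  -- The sum vanishes near `ι₀`, because rays with opening angle `α` and `n` segments
  -- starting there have both endpoints in `E`.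
  have hG0 : ∀ j, ∀ᶠ φ in 𝓝 ι₀, G j φ = 0 := by
    intro j
    induction j with
    | zero =>
      filter_upwards [hι₀] with ι hι
      exact hray ⟨n, 0, α, ι, ι + n * α, hn, hι.1, hι.2, by simp, hsin⟩
    | succ j ih =>
      filter_upwards [ih.eventually_nhds] with ι hι
      exact (hG j ι).unique ((hasDerivAt_const ι (0 : ℝ)).congr_of_eventuallyEq hι)
  obtain ⟨hpos, hmono, hdiv⟩ :=
    (h𝓜 R hR).sqrt (show 0 < (n : ℝ) * C by positivity) hρ
  have hGzero : ∀ φ, G 0 φ = 0 := by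
    intro φ
    obtain ⟨k, hk⟩ := exists_nat_ge ((ι₀ - φ) / (2 * Real.pi))
    rw [div_le_iff₀ hπ] at hk
    have h1 := denjoy_carleman hG hpos hGb hmono hdiv (fun j => (hG0 j).self_of_nhds)
      (show ι₀ ≤ φ + k * (2 * Real.pi) by linarith)
    have hper : Function.Periodic (G 0) (2 * Real.pi) := fun x => by
      refine Finset.sum_congr rfl fun l _ => ?_
      rw [add_right_comm, hFper 0]
    rwa [hper.nat_mul k φ] at h1
  -- Telescoping: `F` is invariant under the rotations by `nα` and by `2π`.
  have hFα : Function.Periodic (F 0) (n * α) := fun φ => by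
    have h1 : G 0 (φ + α) - G 0 φ = F 0 (φ + n * α) - F 0 (φ + (0 : ℕ) * α) := by
      rw [← Finset.sum_range_sub (fun l : ℕ => F 0 (φ + l * α)) n, Finset.sum_sub_distrib]
      congr 1
      refine Finset.sum_congr rfl fun l _ => ?_
      congr 1
      push_cast
      ring
    rw [hGzero, hGzero] at h1
    simp only [Nat.cast_zero, zero_mul, add_zero] at h1
    linarith
  have hFcont : Continuous (F 0) :=
    (continuous_chordMean (hD.continuousOn 0)).comp (continuous_id.prodMk continuous_const)
  have hirr : Irrational (n * α / (2 * Real.pi)) := by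
    rw [mul_div_assoc]
    exact hα.natCast_mul hn.ne'
  have hconst := eq_const_of_periodic hFcont hirr hFα (hFper 0)
  have h2 := hGzero 0
  simp only [hGdef, hconst, Finset.sum_const, Finset.card_range, nsmul_eq_mul] at h2
  rcases mul_eq_zero.1 h2 with h3 | h3
  · exact absurd (Nat.cast_eq_zero.1 h3) hn.ne'
  · exact (hconst φ).trans h3

theorem AngularJet.eqOn_zero {𝓜 : ℝ → ℕ → ℝ}
    (h𝓜 : ∀ R ∈ Set.Ioc (0 : ℝ) 1, IsQuasianalyticWeight (𝓜 R)) {D : ℕ → ℂ → ℝ}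
    (hD : AngularJet 𝓜 D) {E : Set Circle} (hE : IsOpen E) (hne : E.Nonempty)
    (hray : ∀ γ : BrokenRay E, ∑ l ∈ Finset.range γ.n,
      chordMean (D 0) (γ.ι + l * γ.α) γ.α = 0) :
    Set.EqOn (D 0) 0 (Metric.closedBall 0 1) := by
  refine eqOn_zero_of_chordMean_eq_zero (hD.continuousOn 0) fun φ => congrFun ?_
  have hdense : Dense {α : ℝ | Irrational (α / (2 * Real.pi))} :=
    dense_irrational.preimage
      (Homeomorph.mulRight₀ (2 * Real.pi)⁻¹ (inv_ne_zero Real.two_pi_pos.ne')).isOpenMap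
  exact Continuous.ext_on hdense
    ((continuous_chordMean (hD.continuousOn 0)).comp (continuous_const.prodMk continuous_id))
    continuous_const fun α hα => hD.chordMean_eq_zero_of_irrational h𝓜 hE hne hray hα φ

/-- The segments of a broken ray have equal lengths, so the average over the ray is the average of
the means over the segments. -/
theorem brokenRayTransform_eq {E : Set Circle} (f : ℂ → ℝ) (γ : BrokenRay E) :
    brokenRayTransform f γ =
      (∑ l ∈ Finset.range γ.n, chordMean f (γ.ι + l * γ.α) γ.α) / γ.n := by
  have hv : ∀ l, γ.vertex (l + 1) = γ.vertex l * (Circle.exp γ.α : ℂ) := fun l => by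
    rw [BrokenRay.vertex, BrokenRay.vertex, ← Circle.coe_mul, ← Circle.exp_add]
    push_cast
    ring_nf
  have hd : ∀ l, dist (γ.vertex l) (γ.vertex (l + 1)) = dist (1 : ℂ) (Circle.exp γ.α : ℂ) :=
    fun l => by
      rw [hv, dist_eq_norm, dist_eq_norm, ← mul_one_sub, norm_mul, BrokenRay.vertex,
        Circle.norm_coe, one_mul]
  have hd0 : dist (1 : ℂ) (Circle.exp γ.α : ℂ) ≠ 0 := fun h => by
    have h1 : Circle.exp γ.α = 1 := Subtype.ext (dist_eq_zero.1 h).symm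
    obtain ⟨m, hm⟩ := Circle.exp_eq_one.1 h1
    refine γ.nondegenerate (Real.sin_eq_zero_iff.2 ⟨m, ?_⟩)
    rw [hm]
    ring
  have hseg : ∀ l, segmentIntegral f (γ.vertex l) (γ.vertex (l + 1)) =
      dist (1 : ℂ) (Circle.exp γ.α : ℂ) * chordMean f (γ.ι + l * γ.α) γ.α := fun l => by
    rw [segmentIntegral, hd, chordMean]
    congr 1
    refine intervalIntegral.integral_congr fun s _ => ?_
    rw [hv, AffineMap.lineMap_apply, AffineMap.lineMap_apply, BrokenRay.vertex]
    simp only [vsub_eq_sub, vadd_eq_add, Complex.real_smul]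
    congr 1
    ring
  rw [brokenRayTransform, unnormalizedTransform, BrokenRay.length]
  simp only [hseg, hd, ← Finset.mul_sum, Finset.sum_const, Finset.card_range, nsmul_eq_mul]
  rw [mul_comm (γ.n : ℝ), mul_div_mul_left _ _ hd0]

theorem angularDeriv_zero (f : ℂ → ℝ) : angularDeriv 0 f = f := by
  funext x
  simp [angularDeriv]

end BrokenRayTomography


theorem theorem2 (E : Set Circle) (hE : IsOpen E) (hne : E.Nonempty) :
    (∀ f : ℂ → ℝ, UniformlyQuasianalytic f → AngularDerivativesDiniLipschitz f →
      (∀ γ : BrokenRay E, brokenRayTransform f γ = 0) →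
        ∀ x ∈ Metric.closedBall (0 : ℂ) 1, f x = 0) ∧
    (∀ 𝓜 : ℝ → ℕ → ℝ, (∀ R ∈ Set.Ioc (0 : ℝ) 1, IsQuasianalyticWeight (𝓜 R)) →
      ∀ f g : ℂ → ℝ, UniformlyInClasses 𝓜 f → UniformlyInClasses 𝓜 g →
        AngularDerivativesDiniLipschitz f → AngularDerivativesDiniLipschitz g →
        (∀ γ : BrokenRay E, brokenRayTransform f γ = brokenRayTransform g γ) →
          Set.EqOn f g (Metric.closedBall (0 : ℂ) 1)) := by
  have hn : ∀ γ : BrokenRay E, (γ.n : ℝ) ≠ 0 := fun γ => Nat.cast_ne_zero.2 γ.n_pos.ne'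
  refine ⟨fun f hf hfD hray x hx => ?_, fun 𝓜 h𝓜 f g hf hg hfD hgD hray x hx => ?_⟩
  · obtain ⟨𝓜, h𝓜, hf⟩ := hf
    have h := (hf.angularJet h𝓜 hfD).eqOn_zero h𝓜 hE hne (fun γ => by
      have := hray γ
      rw [brokenRayTransform_eq, div_eq_zero_iff, or_iff_left (hn γ)] at this
      rwa [angularDeriv_zero]) hx
    simpa [angularDeriv_zero] using h
  · have h := ((hf.angularJet h𝓜 hfD).sub h𝓜 (hg.angularJet h𝓜 hgD)).eqOn_zero h𝓜 hE hne
      (fun γ => by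
        have := hray γ
        rw [brokenRayTransform_eq, brokenRayTransform_eq, div_left_inj' (hn γ)] at this
        simp only [Pi.sub_apply, angularDeriv_zero, chordMean_sub hf.1 hg.1,
          Finset.sum_sub_distrib, this, sub_self]) hx
    simpa [angularDeriv_zero, sub_eq_zero] using h
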